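/- Let $r \geq 0$ and $k \geq 1$ be integers, let $n = k + r$, and let $\mathbf{a} = (k-1, \dots, k-1)$ have length $r$. Let $\mathbb{Q}[\mathbf{x}_n, \boldsymbol{\theta}_n]$ be superspace of rank $n$: the unital associative $\mathbb{Q}$-algebra generated by $x_1, \dots, x_n, \theta_1, \dots, \theta_n$ subject to $x_i x_j = x_j x_i$, $x_i \theta_j = \theta_j x_i$, $\theta_i \theta_j = -\theta_j \theta_i$, bigraded by $x$-degree and $\theta$-degree, with the $\mathfrak{S}_n$-action $w \cdot x_i = x_{w(i)}$, $w \cdot \theta_i = \theta_{w(i)}$. Let $$\Delta_n(\mathbf{a}) = \sum_{w \in \mathfrak{S}_n} \mathrm{sign}(w)\, w \cdot \left( x_1^{k-1} \cdots x_r^{k-1}\, x_{r+1}^{k-1} x_{r+2}^{k-2} \cdots x_{n-1}^{1} x_n^{0} \cdot \theta_1 \theta_2 \cdots \theta_r \right).$$ Let $\partial_i$ be partial differentiation in $x_i$ with the $\theta$-variables regarded as constants, and let $\partial_i^\theta$ be the $\mathbb{Q}[x_1,\dots,x_n]$-linear operator which, for $j_1 < \cdots < j_m$, sends $\theta_{j_1}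 \cdots \theta_{j_m}$ to $(-1)^{s-1} \theta_{j_1} \cdots \widehat{\theta_{j_s}} \cdots \theta_{j_m}$ if $j_s = i$, and to $0$ if $i \notin \{j_1, \dots, j_m\}$. Let $W_n(\mathbf{a})$ be the smallest $\mathbb{Q}$-linear subspace of $\mathbb{Q}[\mathbf{x}_n, \boldsymbol{\theta}_n]$ which contains $\Delta_n(\mathbf{a})$ and is closed under all the operators $\partial_1, \dots, \partial_n, \partial_1^\theta, \dots, \partial_n^\theta$; it is stable under $\mathfrak{S}_n$. Let $W_n(\mathbf{a})_0$ be its subspace of elements of $\theta$-degree $0$, graded by $x$-degree. Let $$R_{n,k} = \mathbb{Q}[x_1, \dots, x_n] / \langle x_1^k, \dots, x_n^k, e_n, e_{n-1}, \dots, e_{n-k+1} \rangle,$$ where $e_d$ is the elementary symmetric polynomial of degree $d$ in $x_1, \dots, x_n$, with its grading by degree and the $\mathfrak{S}_n$-action permuting the variables. Then $W_n(\mathbf{a})_0 \cong R_{n,k}$ as singly graded $\mathfrak{S}_n$-modules; that is, there is a $\mathbb{Q}$-linear $\mathfrak{S}_n$-equivariant isomorphism $W_n(\mathbf{a})_0 \to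 R_{n,k}$ which, for every $d \geq 0$, maps the $x$-degree $d$ piece of $W_n(\mathbf{a})_0$ onto the degree $d$ piece of $R_{n,k}$. -/

import Mathlib

open scoped TensorProduct

noncomputable section

namespace SuperVandermonde

/-- The span of the anticommuting variables, with basis `e_i = Pi.single i 1`. -/
abbrev ThetaSpace (n : ℕ) : Type := Fin n → ℚ

/-- Superspace of rank `n`, in the tensor product model
`ℚ[x_1, …, x_n] ⊗ ⋀(θ_1, …, θ_n)`; the `x`-variables commute with everything and the
`θ`-variables anticommute. -/
abbrev Superspace (n : ℕ) : Type :=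
  MvPolynomial (Fin n) ℚ ⊗[ℚ] ExteriorAlgebra ℚ (ThetaSpace n)

/-- The generator `θ_i` of the exterior algebra. -/
def theta {n : ℕ} (i : Fin n) : ExteriorAlgebra ℚ (ThetaSpace n) :=
  ExteriorAlgebra.ι ℚ (Pi.single i 1)

/-- The action of `w` on the exterior algebra: the algebra map with `θ_i ↦ θ_{w(i)}`. -/
def permTheta {n : ℕ} (w : Equiv.Perm (Fin n)) :
    ExteriorAlgebra ℚ (ThetaSpace n) →ₐ[ℚ] ExteriorAlgebra ℚ (ThetaSpace n) :=
  ExteriorAlgebra.map (LinearMap.funLeft ℚ ℚ (w⁻¹ : Equiv.Perm (Fin n)))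

theorem permTheta_theta {n : ℕ} (w : Equiv.Perm (Fin n)) (i : Fin n) :
    permTheta w (theta i) = theta (w i) := by
  unfold permTheta theta
  rw [ExteriorAlgebra.map_apply_ι]
  congr 1
  ext j
  simp only [LinearMap.funLeft_apply, Pi.single_apply, Equiv.Perm.inv_eq_iff_eq]

theorem permTheta_one {n : ℕ} : permTheta (1 : Equiv.Perm (Fin n)) = AlgHom.id ℚ _ := by
  unfold permTheta
  rw [← ExteriorAlgebra.map_id]
  rfl

theorem permTheta_mul {n : ℕ} (v w : Equiv.Perm (Fin n)) :
    permTheta (v * w) = (permTheta v).comp (permTheta w) := by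
  unfold permTheta
  rw [ExteriorAlgebra.map_comp_map, mul_inv_rev]
  rfl

/-- The diagonal action of the symmetric group on superspace:
`w · x_i = x_{w(i)}` and `w · θ_i = θ_{w(i)}`. -/
def superRep (n : ℕ) : Representation ℚ (Equiv.Perm (Fin n)) (Superspace n) where
  toFun w := TensorProduct.map (MvPolynomial.rename w).toLinearMap (permTheta w).toLinearMap
  map_one' := by
    ext
    simp [permTheta_one]
  map_mul' v w := by
    rw [Module.End.mul_eq_comp, ← TensorProduct.map_comp, permTheta_mul]
    congr 1
    refine LinearMap.ext fun p => ?_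
    simp [MvPolynomial.rename_rename, Equiv.Perm.coe_mul]

/-- The partial derivative `∂_i` in `x_i`, with the `θ`-variables regarded as constants. -/
def partialX {n : ℕ} (i : Fin n) : Superspace n →ₗ[ℚ] Superspace n :=
  TensorProduct.map (MvPolynomial.pderiv i).toLinearMap LinearMap.id

/-- Left contraction by the `i`-th coordinate functional on the exterior algebra: the map with
`θ_{j_1} ⋯ θ_{j_r} ↦ (-1)^(s-1) θ_{j_1} ⋯ θ_{j_{s-1}} θ_{j_{s+1}} ⋯ θ_{j_r}` if `j_s = i`,
and `0` if `i` does not occur. -/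
def contractTheta {n : ℕ} (i : Fin n) :
    ExteriorAlgebra ℚ (ThetaSpace n) →ₗ[ℚ] ExteriorAlgebra ℚ (ThetaSpace n) :=
  CliffordAlgebra.contractLeft (Q := (0 : QuadraticForm ℚ (ThetaSpace n))) (LinearMap.proj i)

/-- The `ℚ[x]`-linear operator `∂_i^θ` on superspace. -/
def partialTheta {n : ℕ} (i : Fin n) : Superspace n →ₗ[ℚ] Superspace n :=
  TensorProduct.map LinearMap.id (contractTheta i)

/-- The superpolynomials that are homogeneous of `x`-degree `d`. -/
def xDegree (n d : ℕ) : Submodule ℚ (Superspace n) :=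
  LinearMap.range (TensorProduct.map (MvPolynomial.homogeneousSubmodule (Fin n) ℚ d).subtype
    (LinearMap.id : ExteriorAlgebra ℚ (ThetaSpace n) →ₗ[ℚ] _))

/-- The superpolynomials that are homogeneous of `θ`-degree `j`. -/
def thetaDegree (n j : ℕ) : Submodule ℚ (Superspace n) :=
  LinearMap.range (TensorProduct.map
    (LinearMap.id : MvPolynomial (Fin n) ℚ →ₗ[ℚ] _) (⋀[ℚ]^j (ThetaSpace n)).subtype)

/-- The antisymmetrizer `ε_n = ∑_w sign(w) w`, acting on superspace. -/
def antisymmetrize {n : ℕ} (f : Superspace n) : Superspace n :=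
  ∑ w : Equiv.Perm (Fin n), ((Equiv.Perm.sign w : ℤ) : ℚ) • superRep n w f

/-- The superspace Vandermonde `Δ_n(a)`, for `n = r + k` and `a` of length `r`: the antisymmetrizer
applied to `x_1^{a_1} ⋯ x_r^{a_r} x_{r+1}^{k-1} x_{r+2}^{k-2} ⋯ x_n^0 θ_1 ⋯ θ_r`. -/
def superVandermonde {r : ℕ} (k : ℕ) (a : Fin r → ℕ) : Superspace (r + k) :=
  antisymmetrize
    (((∏ i : Fin r, MvPolynomial.X (Fin.castAdd k i) ^ a i) *
        ∏ j : Fin k, MvPolynomial.X (Fin.natAdd r j) ^ (k - 1 - (j : ℕ))) ⊗ₜ[ℚ]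
      (List.ofFn fun i : Fin r => theta (Fin.castAdd k i)).prod)

/-- `W_n(a)`: the smallest `ℚ`-linear subspace of superspace that contains `Δ_n(a)` and is closed
under all operators `∂_i` and `∂_i^θ`. -/
def W {r : ℕ} (k : ℕ) (a : Fin r → ℕ) : Submodule ℚ (Superspace (r + k)) :=
  sInf {p | superVandermonde k a ∈ p ∧
    (∀ i, ∀ f ∈ p, partialX i f ∈ p) ∧ (∀ i, ∀ f ∈ p, partialTheta i f ∈ p)}

theorem superRep_antisymmetrize {n : ℕ} (w : Equiv.Perm (Fin n)) (f : Superspace n) :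
    superRep n w (antisymmetrize f) = ((Equiv.Perm.sign w : ℤ) : ℚ) • antisymmetrize f := by
  unfold antisymmetrize
  rw [map_sum, Finset.smul_sum, ← Equiv.sum_comp (Equiv.mulLeft w)
    (fun v => ((Equiv.Perm.sign w : ℤ) : ℚ) •
      (((Equiv.Perm.sign v : ℤ) : ℚ) • superRep n v f))]
  refine Finset.sum_congr rfl fun v _ => ?_
  rw [map_smul, smul_smul, Equiv.coe_mulLeft, map_mul, map_mul, Module.End.mul_apply]
  congr 1
  rcases Int.units_eq_one_or (Equiv.Perm.sign w) with h | h <;> simp [h]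

theorem superRep_partialX {n : ℕ} (w : Equiv.Perm (Fin n)) (i : Fin n) (f : Superspace n) :
    superRep n w (partialX i f) = partialX (w i) (superRep n w f) := by
  induction f using TensorProduct.induction_on with
  | zero => simp
  | add f g hf hg => simp only [map_add, hf, hg]
  | tmul p q =>
    simp [superRep, partialX, MvPolynomial.pderiv_rename w.injective]

theorem permTheta_contractTheta {n : ℕ} (w : Equiv.Perm (Fin n)) (i : Fin n)
    (q : ExteriorAlgebra ℚ (ThetaSpace n)) :
    permTheta w (contractTheta i q) = contractTheta (w i) (permTheta w q) := by
  induction q using CliffordAlgebra.left_induction with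
  | algebraMap c =>
    rw [AlgHom.commutes, contractTheta, contractTheta, CliffordAlgebra.contractLeft_algebraMap,
      CliffordAlgebra.contractLeft_algebraMap, map_zero]
  | add x y hx hy => simp only [map_add, hx, hy]
  | ι_mul x m hx =>
    have h1 : permTheta w (CliffordAlgebra.ι 0 m) =
        CliffordAlgebra.ι 0 (LinearMap.funLeft ℚ ℚ (w⁻¹ : Equiv.Perm (Fin n)) m) :=
      ExteriorAlgebra.map_apply_ι _ _
    unfold contractTheta at hx ⊢
    rw [CliffordAlgebra.contractLeft_ι_mul, map_mul, h1, CliffordAlgebra.contractLeft_ι_mul,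
      map_sub, map_smul, map_mul, h1, hx]
    simp [LinearMap.funLeft_apply]

theorem superRep_partialTheta {n : ℕ} (w : Equiv.Perm (Fin n)) (i : Fin n) (f : Superspace n) :
    superRep n w (partialTheta i f) = partialTheta (w i) (superRep n w f) := by
  induction f using TensorProduct.induction_on with
  | zero => simp
  | add f g hf hg => simp only [map_add, hf, hg]
  | tmul p q => simp [superRep, partialTheta, permTheta_contractTheta]

theorem superRep_mem_W {r : ℕ} (k : ℕ) (a : Fin r → ℕ) (w : Equiv.Perm (Fin (r + k)))
    {f : Superspace (r + k)} (hf : f ∈ W k a) : superRep (r + k) w f ∈ W k a := by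
  rw [W, Submodule.mem_sInf] at hf ⊢
  intro p hp
  refine hf (p.comap (superRep (r + k) w)) ⟨?_, fun i g hg => ?_, fun i g hg => ?_⟩
  · rw [Submodule.mem_comap, superVandermonde, superRep_antisymmetrize]
    exact p.smul_mem _ hp.1
  · rw [Submodule.mem_comap, superRep_partialX]
    exact hp.2.1 _ _ hg
  · rw [Submodule.mem_comap, superRep_partialTheta]
    exact hp.2.2 _ _ hg

theorem permTheta_mem_exteriorPower {n j : ℕ} (w : Equiv.Perm (Fin n))
    {q : ExteriorAlgebra ℚ (ThetaSpace n)} (hq : q ∈ ⋀[ℚ]^j (ThetaSpace n)) :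
    permTheta w q ∈ ⋀[ℚ]^j (ThetaSpace n) := by
  rw [← ExteriorAlgebra.ιMulti_span_fixedDegree] at hq ⊢
  induction hq using Submodule.span_induction with
  | mem x hx =>
    obtain ⟨m, rfl⟩ := hx
    rw [permTheta, ExteriorAlgebra.map_apply_ιMulti]
    exact Submodule.subset_span ⟨_, rfl⟩
  | zero => simp
  | add x y _ _ hx hy => simpa only [map_add] using add_mem hx hy
  | smul c x _ hx => simpa only [map_smul] using Submodule.smul_mem _ c hx

theorem superRep_mem_thetaDegree {n j : ℕ} (w : Equiv.Perm (Fin n)) {f : Superspace n}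
    (hf : f ∈ thetaDegree n j) : superRep n w f ∈ thetaDegree n j := by
  obtain ⟨g, rfl⟩ := hf
  induction g using TensorProduct.induction_on with
  | zero => simp
  | add f g hf hg => simpa only [map_add] using add_mem hf hg
  | tmul p q =>
    have hq := permTheta_mem_exteriorPower w q.2
    exact ⟨MvPolynomial.rename w p ⊗ₜ ⟨_, hq⟩, by simp [superRep]⟩

/-- `W_n(a)_0`: the part of `W_n(a)` of `θ`-degree zero. -/
def WZero {r : ℕ} (k : ℕ) (a : Fin r → ℕ) : Submodule ℚ (Superspace (r + k)) :=
  W k a ⊓ thetaDegree (r + k) 0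

/-- The action of the symmetric group on `W_n(a)_0`, restricted from superspace. -/
def WZeroRep {r : ℕ} (k : ℕ) (a : Fin r → ℕ) :
    Representation ℚ (Equiv.Perm (Fin (r + k))) (WZero k a) :=
  (superRep (r + k)).subrepresentation (WZero k a) fun w _ hf =>
    ⟨superRep_mem_W k a w hf.1, superRep_mem_thetaDegree w hf.2⟩

/-- The piece of `W_n(a)_0` of `x`-degree `d`. -/
def WZeroDegree {r : ℕ} (k : ℕ) (a : Fin r → ℕ) (d : ℕ) : Submodule ℚ (WZero k a) :=
  (xDegree (r + k) d).comap (WZero k a).subtype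

/-- The ideal `I_{n,k}` generated by `x_1^k, …, x_n^k` and the top `k` elementary symmetric
polynomials `e_n, e_{n-1}, …, e_{n-k+1}`. -/
def genCoinvariantIdeal (n k : ℕ) : Ideal (MvPolynomial (Fin n) ℚ) :=
  Ideal.span (Set.range (fun i : Fin n => MvPolynomial.X i ^ k) ∪
    {e | ∃ d, d ≤ n ∧ n < d + k ∧ e = MvPolynomial.esymm (Fin n) ℚ d})

/-- The generalized coinvariant ring `R_{n,k} = ℚ[x_1, …, x_n] / I_{n,k}`. -/
abbrev GenCoinvariantRing (n k : ℕ) : Type :=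
  MvPolynomial (Fin n) ℚ ⧸ genCoinvariantIdeal n k

theorem genCoinvariantIdeal_le_comap (n k : ℕ) (w : Equiv.Perm (Fin n)) :
    genCoinvariantIdeal n k ≤
      (genCoinvariantIdeal n k).comap (MvPolynomial.rename w : _ →ₐ[ℚ] _) := by
  conv_lhs => rw [genCoinvariantIdeal]
  rw [Ideal.span_le]
  rintro _ (⟨i, rfl⟩ | ⟨d, hd, hd', rfl⟩)
  · refine Ideal.subset_span (Or.inl ⟨w i, ?_⟩)
    simp
  · refine Ideal.subset_span (Or.inr ⟨d, hd, hd', ?_⟩)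
    exact MvPolynomial.rename_esymm (Fin n) ℚ d w

/-- The action of the symmetric group on `R_{n,k}` by permuting the variables. -/
def genCoinvariantRep (n k : ℕ) :
    Representation ℚ (Equiv.Perm (Fin n)) (GenCoinvariantRing n k) where
  toFun w := (Ideal.quotientMapₐ (genCoinvariantIdeal n k) (MvPolynomial.rename w)
    (genCoinvariantIdeal_le_comap n k w)).toLinearMap
  map_one' := by
    refine LinearMap.ext fun f => ?_
    obtain ⟨p, rfl⟩ := Ideal.Quotient.mk_surjective f
    simp
  map_mul' v w := by
    refine LinearMap.ext fun f => ?_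
    obtain ⟨p, rfl⟩ := Ideal.Quotient.mk_surjective f
    simp [MvPolynomial.rename_rename, Equiv.Perm.coe_mul]

/-- The piece of `R_{n,k}` of degree `d`: the image of the homogeneous polynomials of degree `d`. -/
def genCoinvariantDegree (n k d : ℕ) : Submodule ℚ (GenCoinvariantRing n k) :=
  (MvPolynomial.homogeneousSubmodule (Fin n) ℚ d).map
    (Ideal.Quotient.mkₐ ℚ (genCoinvariantIdeal n k)).toLinearMap

end SuperVandermonde

end

/-! Write Δ_c for `genVandermonde k c`, where c picks s distinct variables. Let H be the space
generated by all Δ_c under differentiation (`harmonicSpace`), and let I be `truncatedIdeal n k s`,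
which is the defining ideal of `R_{n,k}` when s = k. The isomorphism sends a harmonic polynomial to
its residue class, and it rests on two facts.

First, W_n(a)_0 = H ⊗ 1 for s = k (`mem_WZero_iff`). Up to a nonzero scalar, the superspace
Vandermonde is a signed sum of terms Δ_c ⊗ (θ-word), so every element of W has coefficients in H.
Conversely, contracting by all of θ_1, …, θ_r isolates a nonzero multiple of one Δ_c, and the
symmetric group and the ∂_i produce the rest of H.

Second, I is the orthogonal complement of H for the apolar pairing, in which multiplication by x_i
is adjoint to ∂_i. The pairing is positive definite over ℚ, so H ∩ I = 0; orthogonal projection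
degree by degree gives H + I = ℚ[x]. No dimension count of the quotient is needed.

The hard inclusion is that a polynomial annihilating every Δ_c lies in I
(`mem_truncatedIdeal_of_forall`). It goes by induction on n, pushing the polynomial modulo I into
higher and higher powers of `X 0`. The parameter s is kept apart from k because this induction
lowers s while k stays fixed. -/

noncomputable section

namespace SuperVandermonde

open MvPolynomial

/-! ### The apolar pairing -/

/-- The product of the factorials of the exponents of a monomial. -/
def expFactorial {σ : Type*} (m : σ →₀ ℕ) : ℚ := m.prod fun _ a => (a.factorial : ℚ)

theorem expFactorial_pos {σ : Type*} (m : σ →₀ ℕ) : 0 < expFactorial m :=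
  Finset.prod_pos fun _ _ => by positivity

theorem expFactorial_eq_prod {σ : Type*} [Fintype σ] (m : σ →₀ ℕ) :
    expFactorial m = ∏ i, ((m i).factorial : ℚ) :=
  Finsupp.prod_fintype _ _ fun _ => by simp

theorem expFactorial_add_single {σ : Type*} [Fintype σ] (m : σ →₀ ℕ) (i : σ) :
    expFactorial (m + Finsupp.single i 1) = (m i + 1) * expFactorial m := by
  classical
  rw [expFactorial_eq_prod, expFactorial_eq_prod, ← Finset.mul_prod_erase _ _ (Finset.mem_univ i),
    ← Finset.mul_prod_erase _ (fun j => ((m j).factorial : ℚ)) (Finset.mem_univ i), ← mul_assoc]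
  congr 1
  · simp [Nat.factorial_succ]
  · refine Finset.prod_congr rfl fun j hj => ?_
    rw [Finsupp.add_apply, Finsupp.single_eq_of_ne (Finset.ne_of_mem_erase hj), add_zero]

theorem expFactorial_mapDomain {σ τ : Type*} (w : σ ≃ τ) (m : σ →₀ ℕ) :
    expFactorial (m.mapDomain w) = expFactorial m :=
  Finsupp.prod_mapDomain_index_inj w.injective

/-- The apolar pairing of polynomials: distinct monomials are orthogonal, and the square length of
a monomial is the product of the factorials of its exponents. Multiplication by a variable is
adjoint to the partial derivative. -/
def apolar (σ : Type*) : MvPolynomial σ ℚ →ₗ[ℚ] MvPolynomial σ ℚ →ₗ[ℚ] ℚ :=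
  (basisMonomials σ ℚ).constr ℚ fun m => expFactorial m • lcoeff ℚ m

theorem apolar_monomial {σ : Type*} (m : σ →₀ ℕ) (c : ℚ) (f : MvPolynomial σ ℚ) :
    apolar σ (monomial m c) f = c * (expFactorial m * coeff m f) := by
  have h : apolar σ (monomial m 1) = expFactorial m • lcoeff ℚ m := by
    have := (basisMonomials σ ℚ).constr_basis ℚ (fun m => expFactorial m • lcoeff ℚ m) m
    rwa [coe_basisMonomials] at this
  rw [show monomial m c = c • monomial m (1 : ℚ) by simp [smul_monomial], map_smul, h]
  simp

theorem apolar_self {σ : Type*} (p : MvPolynomial σ ℚ) :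
    apolar σ p p = ∑ m ∈ p.support, expFactorial m * coeff m p ^ 2 := by
  conv_lhs => rw [congrArg (apolar σ) p.as_sum]
  rw [map_sum, LinearMap.sum_apply]
  refine Finset.sum_congr rfl fun m _ => ?_
  rw [apolar_monomial]; ring

/-- The self-pairing is a sum of rational squares with positive weights. -/
theorem eq_zero_of_apolar_self {σ : Type*} {p : MvPolynomial σ ℚ} (h : apolar σ p p = 0) :
    p = 0 := by
  rw [apolar_self, Finset.sum_eq_zero_iff_of_nonneg
    fun m _ => mul_nonneg (expFactorial_pos m).le (sq_nonneg _)] at h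
  ext m
  by_cases hm : m ∈ p.support
  · simpa [(expFactorial_pos m).ne'] using h m hm
  · simpa using hm

theorem apolar_X_mul {σ : Type*} [Fintype σ] (i : σ) (p f : MvPolynomial σ ℚ) :
    apolar σ (X i * p) f = apolar σ p (pderiv i f) := by
  induction p using MvPolynomial.induction_on' with
  | add p p' hp hp' => simp [mul_add, hp, hp']
  | monomial m c =>
    rw [X, monomial_mul, apolar_monomial, apolar_monomial, coeff_pderiv, add_comm,
      expFactorial_add_single]
    ring

theorem apolar_rename {σ τ : Type*} (w : σ ≃ τ) (p q : MvPolynomial σ ℚ) :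
    apolar τ (rename w p) (rename w q) = apolar σ p q := by
  induction p using MvPolynomial.induction_on' with
  | add p p' hp hp' => simp [hp, hp']
  | monomial m c =>
    rw [rename_monomial, apolar_monomial, apolar_monomial, coeff_rename_mapDomain _ w.injective,
      expFactorial_mapDomain]

theorem apolar_eq_zero_of_isHomogeneous {σ : Type*} {p q : MvPolynomial σ ℚ} {d e : ℕ}
    (hp : p.IsHomogeneous d) (hq : q.IsHomogeneous e) (h : d ≠ e) : apolar σ p q = 0 := by
  rw [congrArg (apolar σ) p.as_sum, map_sum, LinearMap.sum_apply]
  refine Finset.sum_eq_zero fun m hm => ?_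
  rw [apolar_monomial, hq.coeff_eq_zero, mul_zero, mul_zero]
  intro hd
  exact h ((IsHomogeneous.degree_eq_sum_deg_support hp hm).trans hd)

/-- The apolar pairing with a power of the first variable reads off a coefficient. -/
theorem apolar_X_zero_pow_mul_rename {n : ℕ} (i : ℕ) (p : MvPolynomial (Fin n) ℚ)
    (f : MvPolynomial (Fin (n + 1)) ℚ) :
    apolar _ (X 0 ^ i * rename Fin.succ p) f =
      i.factorial * apolar _ p ((finSuccEquiv ℚ n f).coeff i) := by
  induction p using MvPolynomial.induction_on' with
  | add p p' hp hp' => simp [mul_add, hp, hp']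
  | monomial m c =>
    have hm : X 0 ^ i * rename Fin.succ (monomial m c) = monomial (m.cons i) c := by
      rw [rename_monomial, X_pow_eq_monomial, monomial_mul, one_mul]
      refine congrArg (fun e => monomial e c) (Finsupp.ext fun j => ?_)
      refine Fin.cases ?_ (fun j => ?_) j
      · simp [Finsupp.mapDomain_of_notMem_range]
      · simp [Finsupp.mapDomain_apply (Fin.succ_injective n)]
    rw [hm, apolar_monomial, apolar_monomial, finSuccEquiv_coeff_coeff, expFactorial_eq_prod,
      expFactorial_eq_prod, Fin.prod_univ_succ]
    simp only [Finsupp.cons_zero, Finsupp.cons_succ]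
    ring

/-! ### Annihilators and powers of the first variable -/

/-- The polynomials that annihilate `f` when they act as differential operators. -/
def apolarIdeal {σ : Type*} (f : MvPolynomial σ ℚ) : Ideal (MvPolynomial σ ℚ) where
  carrier := {p | ∀ q, apolar σ (q * p) f = 0}
  add_mem' ha hb q := by rw [mul_add, map_add, LinearMap.add_apply, ha, hb, add_zero]
  zero_mem' q := by simp
  smul_mem' c p hp q := by rw [smul_eq_mul, ← mul_assoc]; exact hp _

theorem mem_apolarIdeal_of_monomial {σ : Type*} {f p : MvPolynomial σ ℚ}
    (h : ∀ m, apolar σ (monomial m 1 * p) f = 0) : p ∈ apolarIdeal f := by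
  intro q
  induction q using MvPolynomial.induction_on' with
  | add q q' hq hq' => simp [add_mul, hq, hq']
  | monomial m c =>
    rw [show monomial m c = c • monomial m (1 : ℚ) by simp [smul_monomial], smul_mul_assoc,
      map_smul, LinearMap.smul_apply, h, smul_zero]

theorem finSuccEquiv_rename_succ {n : ℕ} (p : MvPolynomial (Fin n) ℚ) :
    finSuccEquiv ℚ n (rename Fin.succ p) = Polynomial.C p := by
  induction p using MvPolynomial.induction_on with
  | C a => simp [finSuccEquiv_apply]
  | add p q hp hq => simp only [map_add, hp, hq]
  | mul_X p i hp => rw [map_mul, map_mul, hp, rename_X, finSuccEquiv_X_succ, map_mul]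

theorem exists_add_X_zero_mul {n : ℕ} (p : MvPolynomial (Fin (n + 1)) ℚ) :
    ∃ g q, p = rename Fin.succ g + X 0 * q := by
  refine ⟨(finSuccEquiv ℚ n p).coeff 0, (finSuccEquiv ℚ n).symm (finSuccEquiv ℚ n p).divX, ?_⟩
  apply (finSuccEquiv ℚ n).injective
  rw [map_add, map_mul, AlgEquiv.apply_symm_apply, finSuccEquiv_X_zero,
    finSuccEquiv_rename_succ]
  exact ((add_comm _ _).trans (Polynomial.X_mul_divX_add _)).symm

/-- Multiplying by `X 0 ^ (m - i)` raises the lowest term to `X 0`-degree m and the rest above it.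
Since f has `X 0`-degree at most m, the rest pairs to zero, and g is tested against the top
coefficient of f only. -/
theorem mem_apolarIdeal_of_X_zero_pow_mul {n i m : ℕ} (him : i ≤ m)
    {f : MvPolynomial (Fin (n + 1)) ℚ} {f' : MvPolynomial (Fin n) ℚ} {c : ℚ} (hc : c ≠ 0)
    (hdeg : (finSuccEquiv ℚ n f).natDegree ≤ m)
    (hcoeff : (finSuccEquiv ℚ n f).coeff m = c • f')
    {g : MvPolynomial (Fin n) ℚ} {q : MvPolynomial (Fin (n + 1)) ℚ}
    (h : X 0 ^ i * (rename Fin.succ g + X 0 * q) ∈ apolarIdeal f) : g ∈ apolarIdeal f' := by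
  have hzero : ∀ q : MvPolynomial (Fin (n + 1)) ℚ, apolar _ (X 0 ^ (m + 1) * q) f = 0 := by
    intro q
    induction q using MvPolynomial.induction_on' with
    | add q q' hq hq' => simp [mul_add, hq, hq']
    | monomial e c =>
      rw [X_pow_eq_monomial, monomial_mul, apolar_monomial, ← Finsupp.cons_tail (_ + e),
        ← finSuccEquiv_coeff_coeff, Polynomial.coeff_eq_zero_of_natDegree_lt]
      · simp
      · simp only [Finsupp.add_apply, Finsupp.single_eq_same]
        omega
  intro t
  have h1 := h (X 0 ^ (m - i) * rename Fin.succ t)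
  rw [show X 0 ^ (m - i) * rename Fin.succ t * (X 0 ^ i * (rename Fin.succ g + X 0 * q)) =
      X 0 ^ m * rename Fin.succ (t * g) + X 0 ^ (m + 1) * (rename Fin.succ t * q) by
    conv_rhs => rw [← Nat.sub_add_cancel him]
    rw [map_mul]; ring, map_add, LinearMap.add_apply, hzero, add_zero,
    apolar_X_zero_pow_mul_rename, hcoeff, map_smul] at h1
  simpa [hc, Nat.factorial_ne_zero] using h1

/-! ### Generalized Vandermondes and their annihilators -/

/-- The product of the Vandermonde determinant in the variables enumerated by `c` and of the
`(k - 1)`-st powers of the other variables. -/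
def genVandermonde {n s : ℕ} (k : ℕ) (c : Fin s → Fin n) : MvPolynomial (Fin n) ℚ :=
  (∏ i ∈ (Finset.univ.image c)ᶜ, X i ^ (k - 1)) *
    (Matrix.vandermonde fun a => (X (c a) : MvPolynomial (Fin n) ℚ)).det

/-- The exponents of the monomial of `genVandermonde k c` that belongs to the permutation `v`. -/
def genVandermondeExp {n s : ℕ} (k : ℕ) (c : Fin s → Fin n) (v : Equiv.Perm (Fin s)) :
    Fin n →₀ ℕ :=
  Finsupp.equivFunOnFinite.symm (Function.extend c (fun a => (v a : ℕ)) fun _ => k - 1)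

theorem genVandermondeExp_apply {n s : ℕ} (k : ℕ) {c : Fin s → Fin n}
    (hc : Function.Injective c) (v : Equiv.Perm (Fin s)) (a : Fin s) :
    genVandermondeExp k c v (c a) = v a := by
  simp [genVandermondeExp, hc.extend_apply]

theorem genVandermondeExp_lt {n s k : ℕ} (hk : 1 ≤ k) (hs : s ≤ k) {c : Fin s → Fin n}
    (hc : Function.Injective c) (v : Equiv.Perm (Fin s)) (i : Fin n) :
    genVandermondeExp k c v i < k := by
  by_cases h : ∃ a, c a = i
  · obtain ⟨a, rfl⟩ := h
    rw [genVandermondeExp_apply k hc]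
    omega
  · simp only [genVandermondeExp, Finsupp.coe_equivFunOnFinite_symm, Function.extend_apply' _ _ _ h]
    omega

theorem prod_X_pow_genVandermondeExp {n s : ℕ} (k : ℕ) {c : Fin s → Fin n}
    (hc : Function.Injective c) (v : Equiv.Perm (Fin s)) :
    (monomial (genVandermondeExp k c v) (1 : ℚ)) =
      (∏ i ∈ (Finset.univ.image c)ᶜ, X i ^ (k - 1)) * ∏ a, X (c a) ^ (v a : ℕ) := by
  rw [monomial_eq, C_1, one_mul, Finsupp.prod_fintype _ _ fun _ => pow_zero _,
    ← Finset.prod_compl_mul_prod (Finset.univ.image c), Finset.prod_image hc.injOn]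
  congr 1
  · refine Finset.prod_congr rfl fun i hi => ?_
    rw [genVandermondeExp, Finsupp.coe_equivFunOnFinite_symm, Function.extend_apply']
    simpa using hi
  · simp only [genVandermondeExp_apply k hc]

theorem det_vandermonde_eq_sum {R : Type*} [CommRing R] {s : ℕ} (x : Fin s → R) :
    (Matrix.vandermonde x).det =
      ∑ v : Equiv.Perm (Fin s), ((Equiv.Perm.sign v : ℤ) : R) * ∏ a, x a ^ (v a : ℕ) := by
  rw [← Matrix.det_transpose, Matrix.det_apply']
  rfl

theorem genVandermonde_eq_sum {n s : ℕ} (k : ℕ) {c : Fin s → Fin n}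
    (hc : Function.Injective c) :
    genVandermonde k c = ∑ v : Equiv.Perm (Fin s),
      monomial (genVandermondeExp k c v) ((Equiv.Perm.sign v : ℤ) : ℚ) := by
  rw [genVandermonde, det_vandermonde_eq_sum, Finset.mul_sum]
  refine Finset.sum_congr rfl fun v _ => ?_
  rw [show (monomial (genVandermondeExp k c v) ((Equiv.Perm.sign v : ℤ) : ℚ)) =
    C ((Equiv.Perm.sign v : ℤ) : ℚ) * monomial (genVandermondeExp k c v) 1 by
      rw [C_mul_monomial, mul_one], prod_X_pow_genVandermondeExp k hc]
  simp only [map_intCast]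
  ring

theorem rename_genVandermonde {n s : ℕ} (k : ℕ) (c : Fin s → Fin n) (w : Equiv.Perm (Fin n)) :
    rename w (genVandermonde k c) = genVandermonde k (w ∘ c) := by
  have h : (Finset.univ.image (w ∘ c))ᶜ = (Finset.univ.image c)ᶜ.image w := by
    ext i
    obtain ⟨j, rfl⟩ := w.surjective i
    simp
  rw [genVandermonde, genVandermonde, map_mul, map_prod, h, Finset.prod_image w.injective.injOn]
  congr 1
  · simp
  · rw [det_vandermonde_eq_sum, det_vandermonde_eq_sum]
    simp

theorem genVandermonde_comp_perm {n s : ℕ} (k : ℕ) (c : Fin s → Fin n)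
    (u : Equiv.Perm (Fin s)) :
    genVandermonde k (c ∘ u) = ((Equiv.Perm.sign u : ℤ) : ℚ) • genVandermonde k c := by
  have h := Matrix.det_permute u (Matrix.vandermonde fun a => (X (c a) : MvPolynomial (Fin n) ℚ))
  rw [genVandermonde, genVandermonde, Finset.image_comp, Finset.image_univ_equiv]
  change _ * ((Matrix.vandermonde fun a => X (c a)).submatrix u id).det = _
  rw [h, smul_eq_C_mul, map_intCast]
  ring

theorem exists_isHomogeneous_genVandermonde {n s : ℕ} (k : ℕ) (c : Fin s → Fin n) :
    ∃ d, (genVandermonde k c).IsHomogeneous d := by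
  refine ⟨∑ i ∈ (Finset.univ.image c)ᶜ, (k - 1) + ∑ a : Fin s, (a : ℕ), ?_⟩
  refine IsHomogeneous.mul (IsHomogeneous.prod _ _ _ fun i _ => isHomogeneous_X_pow _ _) ?_
  rw [det_vandermonde_eq_sum]
  refine IsHomogeneous.sum _ _ _ fun v _ => ?_
  rw [← Equiv.sum_comp v, ← zero_add (∑ a, _), ← map_intCast (C : ℚ →+* MvPolynomial (Fin n) ℚ)]
  exact (isHomogeneous_C _ _).mul (IsHomogeneous.prod _ _ _ fun a _ => isHomogeneous_X_pow _ _)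

theorem sum_range_card_le_sum (S : Finset ℕ) : ∑ i ∈ Finset.range S.card, i ≤ ∑ i ∈ S, i := by
  refine Finset.induction_on_max S (by simp) fun a S ha ih => ?_
  have hn : a ∉ S := fun h => lt_irrefl _ (ha a h)
  have hcard : S.card ≤ a := by
      simpa using Finset.card_le_card (fun x hx => Finset.mem_range.2 (ha x hx) : S ⊆ Finset.range a)
  rw [Finset.card_insert_of_notMem hn, Finset.sum_range_succ, Finset.sum_insert hn]
  omega

theorem sum_fin_le_sum_of_injective {s : ℕ} {m : Fin s → ℕ} (hm : Function.Injective m) :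
    ∑ a : Fin s, (a : ℕ) ≤ ∑ a, m a := by
  have h := sum_range_card_le_sum (Finset.univ.image m)
  rwa [Finset.sum_image hm.injOn, Finset.card_image_of_injective _ hm, Finset.card_univ,
    Fintype.card_fin, Finset.sum_range] at h

theorem X_pow_mem_apolarIdeal {n s k : ℕ} (hk : 1 ≤ k) (hs : s ≤ k) {c : Fin s → Fin n}
    (hc : Function.Injective c) (i : Fin n) : X i ^ k ∈ apolarIdeal (genVandermonde k c) := by
  classical
  refine mem_apolarIdeal_of_monomial fun m => ?_
  rw [X_pow_eq_monomial, monomial_mul, apolar_monomial, genVandermonde_eq_sum k hc, coeff_sum,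
    Finset.sum_eq_zero]
  · simp
  · intro v _
    rw [coeff_monomial, if_neg]
    intro h
    have := genVandermondeExp_lt hk hs hc v i
    rw [h] at this
    simp at this

/-- Test against a monomial m. If m repeats an exponent on c, the swap of two variables fixes m and
e_d but negates Δ_c. Otherwise the exponents of m on c already sum to at least 0 + ⋯ + (s - 1), the
total that Δ_c has there, so a monomial of e_d that contributes must avoid c. Only n - s < d
variables are left for it. -/
theorem esymm_mem_apolarIdeal {n s d : ℕ} (k : ℕ) (hd : n < d + s) {c : Fin s → Fin n}
    (hc : Function.Injective c) : esymm (Fin n) ℚ d ∈ apolarIdeal (genVandermonde k c) := by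
  classical
  refine mem_apolarIdeal_of_monomial fun m => ?_
  by_cases hm : Function.Injective (m ∘ c)
  · rw [esymm_eq_sum_monomial, Finset.mul_sum, map_sum, LinearMap.sum_apply]
    refine Finset.sum_eq_zero fun A hA => ?_
    rw [monomial_mul, apolar_monomial, genVandermonde_eq_sum k hc, coeff_sum,
      Finset.sum_eq_zero (s := (Finset.univ : Finset (Equiv.Perm (Fin s))))]
    · simp
    intro v _
    rw [coeff_monomial, if_neg]
    intro h
    have h1 : ∑ a, (v a : ℕ) = ∑ a, m (c a) + ∑ a, (∑ i ∈ A, Finsupp.single i 1 : Fin n →₀ ℕ) (c a) := by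
      rw [← Finset.sum_add_distrib]
      refine Finset.sum_congr rfl fun a _ => ?_
      rw [← genVandermondeExp_apply k hc, h, Finsupp.add_apply]
    have h2 := sum_fin_le_sum_of_injective hm
    rw [Equiv.sum_comp v fun a => (a : ℕ)] at h1
    simp only [Function.comp_apply] at h2
    have h3 : ∑ a, (∑ i ∈ A, Finsupp.single i 1 : Fin n →₀ ℕ) (c a) = 0 := by omega
    have h4 : A ⊆ (Finset.univ.image c)ᶜ := by
      intro i hi
      simp only [Finset.mem_compl, Finset.mem_image, Finset.mem_univ, true_and, not_exists]
      rintro a rfl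
      have h5 := Finset.sum_eq_zero_iff.1 h3 a (Finset.mem_univ a)
      rw [Finsupp.finsetSum_apply] at h5
      simpa using Finset.sum_eq_zero_iff.1 h5 (c a) hi
    have h6 := Finset.card_le_card h4
    rw [Finset.card_compl, Finset.card_image_of_injective _ hc, (Finset.mem_powersetCard.1 hA).2] at h6
    have h7 := Fintype.card_le_of_injective c hc
    simp only [Fintype.card_fin, Finset.card_univ] at h6 h7
    omega
  · simp only [Function.Injective, not_forall] at hm
    obtain ⟨a, b, hab, hne⟩ := hm
    have h1 := apolar_rename (Equiv.swap (c a) (c b)) (monomial m 1 * esymm (Fin n) ℚ d)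
      (genVandermonde k c)
    have h2 : rename (Equiv.swap (c a) (c b)) (genVandermonde k c) = - genVandermonde k c := by
      rw [rename_genVandermonde, show Equiv.swap (c a) (c b) ∘ c = c ∘ Equiv.swap a b from
        (funext fun x => hc.swap_apply a b x), genVandermonde_comp_perm, Equiv.Perm.sign_swap hne]
      simp
    have h3 : m.mapDomain (Equiv.swap (c a) (c b)) = m := by
      ext i
      rw [← Finsupp.equivMapDomain_eq_mapDomain, Finsupp.equivMapDomain_apply, Equiv.symm_swap,
        Equiv.swap_apply_def]
      simp only [Function.comp_apply] at hab
      split_ifs with h h <;> simp [h, hab]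
    rw [map_mul, rename_esymm, rename_monomial, h3, h2, map_neg] at h1
    linarith

/-! ### The ideal under adding a variable -/

/-- The ideal generated by the `k`-th powers of the variables and the top `s` elementary symmetric
polynomials. -/
def truncatedIdeal (n k s : ℕ) : Ideal (MvPolynomial (Fin n) ℚ) :=
  Ideal.span (Set.range (fun i : Fin n => MvPolynomial.X i ^ k) ∪
    {e | ∃ d, d ≤ n ∧ n < d + s ∧ e = MvPolynomial.esymm (Fin n) ℚ d})

theorem truncatedIdeal_le_apolarIdeal {n s k : ℕ} (hk : 1 ≤ k) (hs : s ≤ k) {c : Fin s → Fin n}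
    (hc : Function.Injective c) : truncatedIdeal n k s ≤ apolarIdeal (genVandermonde k c) := by
  rw [truncatedIdeal, Ideal.span_le]
  rintro _ (⟨i, rfl⟩ | ⟨d, -, hd, rfl⟩)
  · exact X_pow_mem_apolarIdeal hk hs hc i
  · exact esymm_mem_apolarIdeal k hd hc

theorem esymm_fin_succ (n d : ℕ) :
    esymm (Fin (n + 1)) ℚ (d + 1) =
      rename Fin.succ (esymm (Fin n) ℚ (d + 1)) + X 0 * rename Fin.succ (esymm (Fin n) ℚ d) := by
  have h : (rename Fin.succ : MvPolynomial (Fin n) ℚ →ₐ[ℚ] MvPolynomial (Fin (n + 1)) ℚ) =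
      aeval fun i => X i.succ := by
    ext i
    simp
  rw [h, aeval_esymm_eq_multiset_esymm, aeval_esymm_eq_multiset_esymm,
    esymm_eq_multiset_esymm, Fin.univ_succ]
  simp only [Finset.cons_val, Multiset.map_cons, Multiset.esymm, Multiset.powersetCard_cons,
    Multiset.map_add, Multiset.sum_add, Finset.map_val, Multiset.map_map]
  rw [← Multiset.sum_map_mul_left]
  simp

theorem esymm_eq_zero_of_lt {n d : ℕ} (h : n < d) : esymm (Fin n) ℚ d = 0 := by
  rw [esymm, Finset.powersetCard_eq_empty.2 (by simpa using h), Finset.sum_empty]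

theorem X_pow_mem_truncatedIdeal (n k s : ℕ) (i : Fin n) : X i ^ k ∈ truncatedIdeal n k s :=
  Ideal.subset_span (Or.inl ⟨i, rfl⟩)

theorem esymm_mem_truncatedIdeal {n s d : ℕ} (k : ℕ) (h : n < d + s) :
    esymm (Fin n) ℚ d ∈ truncatedIdeal n k s := by
  rcases le_or_gt d n with hd | hd
  · exact Ideal.subset_span (Or.inr ⟨d, hd, h, rfl⟩)
  · rw [esymm_eq_zero_of_lt hd]
    exact zero_mem _

/-- Modulo `X 0`, e_d in n + 1 variables becomes e_d in the last n. The bounds match because d > n -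
s is the same as d > (n + 1) - (s + 1). -/
theorem rename_succ_mem_sup {n k s : ℕ} {g : MvPolynomial (Fin n) ℚ}
    (hg : g ∈ truncatedIdeal n k s) :
    rename Fin.succ g ∈ truncatedIdeal (n + 1) k (s + 1) ⊔ Ideal.span {X 0} := by
  have h0 : (X 0 : MvPolynomial (Fin (n + 1)) ℚ) ∈
      truncatedIdeal (n + 1) k (s + 1) ⊔ Ideal.span {X 0} :=
    Ideal.mem_sup_right (Ideal.mem_span_singleton_self _)
  revert g
  change truncatedIdeal n k s ≤
    (truncatedIdeal (n + 1) k (s + 1) ⊔ Ideal.span {X 0}).comap (rename Fin.succ : _ →ₐ[ℚ] _)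
  conv_lhs => rw [truncatedIdeal]
  rw [Ideal.span_le]
  rintro _ (⟨i, rfl⟩ | ⟨d, -, hd, rfl⟩) <;> simp only [SetLike.mem_coe, Ideal.mem_comap]
  · rw [map_pow, rename_X]
    exact Ideal.mem_sup_left (X_pow_mem_truncatedIdeal _ _ _ _)
  · cases d with
    | zero =>
      rw [esymm_zero, map_one, ← esymm_zero (Fin (n + 1)) ℚ]
      exact Ideal.mem_sup_left (esymm_mem_truncatedIdeal k (by omega))
    | succ d =>
      rw [eq_sub_of_add_eq (esymm_fin_succ n d).symm]
      exact sub_mem (Ideal.mem_sup_left (esymm_mem_truncatedIdeal k (by omega)))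
        (Ideal.mul_mem_right _ _ h0)

/-- With primes for the last n variables, e_{n-t} = e'_{n-t} + x_0 e'_{n-t-1}. Each use of this
relation lowers the index of e' by one at the cost of one factor x_0, starting from e_{n+1} = x_0
e'_n. -/
theorem X_zero_pow_mul_esymm_mem {n k s t : ℕ} (hts : t < s) (htn : t ≤ n) :
    X 0 ^ (t + 1) * rename Fin.succ (esymm (Fin n) ℚ (n - t)) ∈ truncatedIdeal (n + 1) k s := by
  induction t with
  | zero =>
    have h := esymm_fin_succ n n
    rw [esymm_eq_zero_of_lt (Nat.lt_succ_self n), map_zero, zero_add] at h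
    rw [zero_add, pow_one, Nat.sub_zero, ← h]
    exact esymm_mem_truncatedIdeal k (by omega)
  | succ t ih =>
    have h := esymm_fin_succ n (n - (t + 1))
    rw [show n - (t + 1) + 1 = n - t by omega] at h
    rw [pow_succ, mul_assoc, ← sub_eq_of_eq_add' h, mul_sub]
    exact sub_mem (Ideal.mul_mem_left _ _ (esymm_mem_truncatedIdeal k (by omega)))
      (ih (by omega) (by omega))

/-- Here s is the same on both sides, unlike in `rename_succ_mem_sup`, and the factor `X 0 ^ s` pays
for it: a generator e_d needs only n - d + 1 ≤ s powers of `X 0`. -/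
theorem X_zero_pow_mul_rename_succ_mem {n k s : ℕ} {g : MvPolynomial (Fin n) ℚ}
    (hg : g ∈ truncatedIdeal n k s) :
    X 0 ^ s * rename Fin.succ g ∈ truncatedIdeal (n + 1) k s := by
  revert g
  have : truncatedIdeal n k s ≤ ((truncatedIdeal (n + 1) k s).colon {X 0 ^ s}).comap
      (rename Fin.succ : _ →ₐ[ℚ] _) := by
    conv_lhs => rw [truncatedIdeal]
    rw [Ideal.span_le]
    rintro _ (⟨i, rfl⟩ | ⟨d, hdn, hd, rfl⟩) <;>
      simp only [SetLike.mem_coe, Ideal.mem_comap, Submodule.mem_colon_singleton, smul_eq_mul]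
    · rw [map_pow, rename_X]
      exact Ideal.mul_mem_right _ _ (X_pow_mem_truncatedIdeal _ _ _ _)
    · have h := X_zero_pow_mul_esymm_mem (k := k) (show n - d < s by omega) (Nat.sub_le n d)
      rw [Nat.sub_sub_self hdn] at h
      rw [mul_comm, show s = (s - (n - d + 1)) + (n - d + 1) by omega, pow_add, mul_assoc]
      rw [show (s - (n - d + 1)) + (n - d + 1) = s by omega]
      exact Ideal.mul_mem_left _ _ h
  intro g hg
  have := this hg
  rwa [Ideal.mem_comap, Submodule.mem_colon_singleton, smul_eq_mul, mul_comm] at this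

/-! ### Vandermondes in one more variable, and the hard inclusion -/

theorem rename_succ_genVandermonde {n s : ℕ} (k : ℕ) (c : Fin s → Fin n) :
    rename Fin.succ (genVandermonde k c) =
      (∏ i ∈ (Finset.univ.image c)ᶜ, X i.succ ^ (k - 1)) *
        (Matrix.vandermonde fun a => (X (c a).succ : MvPolynomial (Fin (n + 1)) ℚ)).det := by
  rw [genVandermonde, map_mul, map_prod, det_vandermonde_eq_sum, det_vandermonde_eq_sum]
  simp

theorem genVandermonde_succ_comp {n s : ℕ} (k : ℕ) (c : Fin s → Fin n) :
    genVandermonde k (Fin.succ ∘ c) = X 0 ^ (k - 1) * rename Fin.succ (genVandermonde k c) := by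
  have h : (Finset.univ.image (Fin.succ ∘ c))ᶜ =
      insert 0 ((Finset.univ.image c)ᶜ.image Fin.succ) := by
    ext i
    refine Fin.cases ?_ (fun i => ?_) i
    · simp [Fin.succ_ne_zero]
    · simp [Fin.succ_ne_zero]
  rw [rename_succ_genVandermonde, genVandermonde, h, Finset.prod_insert (by simp [Fin.succ_ne_zero]),
    Finset.prod_image (Fin.succ_injective n).injOn, mul_assoc]
  rfl

theorem genVandermonde_cons {n s : ℕ} (k : ℕ) (c : Fin s → Fin n) :
    genVandermonde k (Fin.cons 0 (Fin.succ ∘ c) : Fin (s + 1) → Fin (n + 1)) =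
      (∏ a, (X (c a).succ - X 0)) * rename Fin.succ (genVandermonde k c) := by
  have h : (Finset.univ.image (Fin.cons 0 (Fin.succ ∘ c) : Fin (s + 1) → Fin (n + 1)))ᶜ =
      (Finset.univ.image c)ᶜ.image Fin.succ := by
    ext i
    refine Fin.cases ?_ (fun i => ?_) i
    · simp [Fin.succ_ne_zero, Fin.exists_fin_succ]
    · simp [Fin.exists_fin_succ, (Fin.succ_ne_zero _).symm]
  rw [rename_succ_genVandermonde, genVandermonde, h,
    Finset.prod_image (Fin.succ_injective n).injOn, Matrix.det_vandermonde, Matrix.det_vandermonde,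
    Fin.prod_univ_succ, Fin.prod_Ioi_zero]
  simp only [Fin.prod_Ioi_succ, Fin.cons_zero, Fin.cons_succ, Function.comp_apply]
  ring

theorem natDegree_prod_C_sub_X {R : Type*} [CommRing R] [Nontrivial R] {s : ℕ} (x : Fin s → R) :
    (∏ a, (Polynomial.C (x a) - Polynomial.X)).natDegree = s ∧
      (∏ a, (Polynomial.C (x a) - Polynomial.X)).coeff s = (-1) ^ s := by
  have h : ∏ a, (Polynomial.C (x a) - Polynomial.X) =
      Polynomial.C ((-1) ^ s) * ∏ a, (Polynomial.X - Polynomial.C (x a)) := by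
    rw [show (Polynomial.C ((-1 : R) ^ s)) = ∏ _a : Fin s, (-1) by simp, ← Finset.prod_mul_distrib]
    exact Finset.prod_congr rfl fun a _ => by ring
  have hm : (∏ a, (Polynomial.X - Polynomial.C (x a))).Monic :=
    Polynomial.monic_prod_of_monic _ _ fun a _ => Polynomial.monic_X_sub_C _
  have hd : (∏ a, (Polynomial.X - Polynomial.C (x a))).natDegree = s := by
    simp
  have hc : (∏ a, (Polynomial.C (x a) - Polynomial.X)).coeff s = (-1) ^ s := by
    have := hm.coeff_natDegree
    rw [hd] at this
    rw [h, Polynomial.coeff_C_mul, this, mul_one]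
  refine ⟨le_antisymm ?_ (Polynomial.le_natDegree_of_ne_zero ?_), hc⟩
  · rw [h]
    exact (Polynomial.natDegree_C_mul_le _ _).trans hd.le
  · rw [hc]
    exact (isUnit_one.neg.pow s).ne_zero

/-- A polynomial that annihilates all the generalized Vandermondes lies in the ideal. -/
theorem mem_truncatedIdeal_of_forall {k : ℕ} (hk : 1 ≤ k) (n s : ℕ) (hs : s ≤ k)
    (p : MvPolynomial (Fin n) ℚ)
    (hp : ∀ c : Fin s → Fin n, Function.Injective c → p ∈ apolarIdeal (genVandermonde k c)) :
    p ∈ truncatedIdeal n k s := by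
  induction n generalizing s with
  | zero =>
    -- In zero variables the only Vandermonde for s = 0 is 1, which forces the constant p to vanish;
    -- for s > 0 the ideal contains e_0 = 1.
    rcases Nat.eq_zero_or_pos s with rfl | hs0
    · have h := hp Fin.elim0 (fun a => a.elim0) 1
      rw [one_mul, eq_C_of_isEmpty p, ← monomial_zero', apolar_monomial] at h
      have h1 : genVandermonde k (Fin.elim0 : Fin 0 → Fin 0) = 1 := by
        simp [genVandermonde]
      rw [h1, coeff_zero_one] at h
      have h2 : coeff 0 p = 0 := by simpa [(expFactorial_pos _).ne'] using h
      rw [eq_C_of_isEmpty p, h2, C_0]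
      exact zero_mem _
    · have h := esymm_mem_truncatedIdeal (n := 0) (s := s) (d := 0) k (by omega)
      rw [esymm_zero] at h
      rw [(Ideal.eq_top_iff_one _).2 h]
      trivial
  | succ n ih =>
    -- Raise the power of `X 0` dividing p modulo the ideal one step at a time; at i = k that power
    -- is itself a generator.
    have key : ∀ i ≤ k, ∃ g, p - X 0 ^ i * g ∈ truncatedIdeal (n + 1) k s := by
      intro i
      induction i with
      | zero => exact fun _ => ⟨p, by simp⟩
      | succ i hi =>
        intro hik
        obtain ⟨g, hg⟩ := hi (by omega)
        have hK : ∀ c : Fin s → Fin (n + 1), Function.Injective c →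
            X 0 ^ i * g ∈ apolarIdeal (genVandermonde k c) := by
          intro c hc
          have := sub_mem (hp c hc) (truncatedIdeal_le_apolarIdeal hk hs hc hg)
          rwa [sub_sub_cancel] at this
        obtain ⟨g₀, q, rfl⟩ := exists_add_X_zero_mul g
        have step : ∃ q', X 0 ^ i * rename Fin.succ g₀ - X 0 ^ (i + 1) * q' ∈
            truncatedIdeal (n + 1) k s := by
          rcases lt_or_ge i s with his | his
          -- Use the Vandermondes that involve variable 0. After s is renamed to s + 1, their degree
          -- in `X 0` is s, with top coefficient ±Δ_c for c of length s, so the induction hypothesis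
          -- applies with s lowered by one.
          · obtain ⟨s, rfl⟩ : ∃ t, s = t + 1 := ⟨s - 1, by omega⟩
            have hg₀ : g₀ ∈ truncatedIdeal n k s := by
              refine ih s (by omega) g₀ fun c hc => ?_
              have hcons : Function.Injective
                  (Fin.cons 0 (Fin.succ ∘ c) : Fin (s + 1) → Fin (n + 1)) := by
                rw [Fin.cons_injective_iff]
                exact ⟨by simp [Fin.succ_ne_zero], (Fin.succ_injective n).comp hc⟩
              have hfs : finSuccEquiv ℚ n (genVandermonde k
                  (Fin.cons 0 (Fin.succ ∘ c) : Fin (s + 1) → Fin (n + 1))) =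
                  (∏ a, (Polynomial.C (X (c a)) - Polynomial.X)) *
                    Polynomial.C (genVandermonde k c) := by
                rw [genVandermonde_cons, map_mul, finSuccEquiv_rename_succ, map_prod]
                simp only [map_sub, finSuccEquiv_X_succ, finSuccEquiv_X_zero]
              have hd := natDegree_prod_C_sub_X fun a => (X (c a) : MvPolynomial (Fin n) ℚ)
              refine mem_apolarIdeal_of_X_zero_pow_mul (m := s) (c := (-1) ^ s) (by omega)
                (by simp) ?_ ?_ (hK _ hcons)
              · rw [hfs]
                exact (Polynomial.natDegree_mul_C_le _ _).trans hd.1.le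
              · rw [hfs, Polynomial.coeff_mul_C, hd.2, smul_eq_C_mul]
                simp
            obtain ⟨a, ha, b, hb, hab⟩ := Submodule.mem_sup.1 (rename_succ_mem_sup hg₀)
            obtain ⟨q', rfl⟩ := Ideal.mem_span_singleton'.1 hb
            refine ⟨q', ?_⟩
            rw [← hab, show X 0 ^ i * (a + q' * X 0) - X 0 ^ (i + 1) * q' = X 0 ^ i * a by ring]
            exact Ideal.mul_mem_left _ _ ha
          -- Use the Vandermondes that omit variable 0; they are `X 0 ^ (k - 1)` times Δ_c in the
          -- other variables. Since i ≥ s, the power `X 0 ^ i` then carries g₀ into the ideal.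
          · have hg₀ : g₀ ∈ truncatedIdeal n k s := by
              refine ih s hs g₀ fun c hc => ?_
              have hfs : finSuccEquiv ℚ n (genVandermonde k (Fin.succ ∘ c)) =
                  Polynomial.C (genVandermonde k c) * Polynomial.X ^ (k - 1) := by
                rw [genVandermonde_succ_comp, map_mul, finSuccEquiv_rename_succ, map_pow,
                  finSuccEquiv_X_zero, mul_comm]
              refine mem_apolarIdeal_of_X_zero_pow_mul (m := k - 1) (c := 1) (by omega)
                one_ne_zero ?_ ?_ (hK _ ((Fin.succ_injective n).comp hc))
              · rw [hfs]
                exact Polynomial.natDegree_C_mul_X_pow_le _ _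
              · rw [hfs, Polynomial.coeff_C_mul_X_pow, if_pos rfl, one_smul]
            refine ⟨0, ?_⟩
            rw [mul_zero, sub_zero, ← Nat.sub_add_cancel his, pow_add, mul_assoc]
            exact Ideal.mul_mem_left _ _ (X_zero_pow_mul_rename_succ_mem hg₀)
        obtain ⟨q', hq'⟩ := step
        refine ⟨q + q', ?_⟩
        have := add_mem hg hq'
        convert this using 1
        ring
    obtain ⟨g, hg⟩ := key k le_rfl
    have := add_mem hg (Ideal.mul_mem_right g _ (X_pow_mem_truncatedIdeal (n + 1) k s 0))
    rwa [sub_add_cancel] at this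

/-! ### The harmonic space as orthogonal complement of the ideal -/

/-- The smallest space of polynomials that contains the generalized Vandermondes and is closed
under partial differentiation. -/
def harmonicSpace (n k s : ℕ) : Submodule ℚ (MvPolynomial (Fin n) ℚ) :=
  sInf {p | (∀ c : Fin s → Fin n, Function.Injective c → genVandermonde k c ∈ p) ∧
    ∀ i, ∀ f ∈ p, pderiv i f ∈ p}

theorem genVandermonde_mem_harmonicSpace {n s : ℕ} (k : ℕ) {c : Fin s → Fin n}
    (hc : Function.Injective c) : genVandermonde k c ∈ harmonicSpace n k s :=
  Submodule.mem_sInf.2 fun _ hp => hp.1 c hc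

theorem pderiv_mem_harmonicSpace {n k s : ℕ} (i : Fin n) {f : MvPolynomial (Fin n) ℚ}
    (hf : f ∈ harmonicSpace n k s) : pderiv i f ∈ harmonicSpace n k s :=
  Submodule.mem_sInf.2 fun p hp => hp.2 i f (Submodule.mem_sInf.1 hf p hp)

theorem harmonicSpace_le {n k s : ℕ} {P : Submodule ℚ (MvPolynomial (Fin n) ℚ)}
    (h1 : ∀ c : Fin s → Fin n, Function.Injective c → genVandermonde k c ∈ P)
    (h2 : ∀ i, ∀ f ∈ P, pderiv i f ∈ P) : harmonicSpace n k s ≤ P :=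
  sInf_le ⟨h1, h2⟩

theorem apolar_eq_zero_of_mem {n k s : ℕ} (hk : 1 ≤ k) (hs : s ≤ k)
    {p q : MvPolynomial (Fin n) ℚ} (hp : p ∈ truncatedIdeal n k s)
    (hq : q ∈ harmonicSpace n k s) : apolar _ p q = 0 := by
  let P : Submodule ℚ (MvPolynomial (Fin n) ℚ) :=
    ⨅ p ∈ truncatedIdeal n k s, LinearMap.ker (apolar _ p)
  have hP : ∀ {q}, q ∈ P ↔ ∀ p ∈ truncatedIdeal n k s, apolar _ p q = 0 := by
    simp [P, Submodule.mem_iInf]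
  refine hP.1 (harmonicSpace_le (P := P) (fun c hc => ?_) (fun i f hf => ?_) hq) p hp
  · refine hP.2 fun p hp => ?_
    simpa using truncatedIdeal_le_apolarIdeal hk hs hc hp 1
  · refine hP.2 fun p hp => ?_
    rw [← apolar_X_mul]
    exact hP.1 hf _ (Ideal.mul_mem_left _ _ hp)

/-- Since H is closed under the ∂_i, which are adjoint to multiplication, orthogonality to H passes
from p to all its multiples. Hence p annihilates every Δ_c. -/
theorem mem_truncatedIdeal_of_apolar {n k s : ℕ} (hk : 1 ≤ k) (hs : s ≤ k)
    {p : MvPolynomial (Fin n) ℚ} (h : ∀ q ∈ harmonicSpace n k s, apolar _ p q = 0) :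
    p ∈ truncatedIdeal n k s := by
  refine mem_truncatedIdeal_of_forall hk n s hs p fun c hc t => ?_
  suffices H : ∀ q ∈ harmonicSpace n k s, apolar _ (t * p) q = 0 from
    H _ (genVandermonde_mem_harmonicSpace k hc)
  induction t using MvPolynomial.induction_on with
  | C a =>
    intro q hq
    rw [← smul_eq_C_mul, map_smul, LinearMap.smul_apply, h q hq, smul_zero]
  | add t t' ht ht' =>
    intro q hq
    rw [add_mul, map_add, LinearMap.add_apply, ht q hq, ht' q hq, add_zero]
  | mul_X t i ht =>
    intro q hq
    rw [mul_comm t, mul_assoc, apolar_X_mul]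
    exact ht _ (pderiv_mem_harmonicSpace i hq)

theorem homogeneousComponent_pderiv {σ : Type*} (d : ℕ) (i : σ) (f : MvPolynomial σ ℚ) :
    homogeneousComponent d (pderiv i f) = pderiv i (homogeneousComponent (d + 1) f) := by
  classical
  ext m
  rw [coeff_homogeneousComponent, coeff_pderiv, coeff_pderiv, coeff_homogeneousComponent, map_add,
    Finsupp.degree_single]
  simp

theorem homogeneousComponent_mem_harmonicSpace {n k s : ℕ} {f : MvPolynomial (Fin n) ℚ}
    (hf : f ∈ harmonicSpace n k s) (d : ℕ) :
    homogeneousComponent d f ∈ harmonicSpace n k s := by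
  let P : Submodule ℚ (MvPolynomial (Fin n) ℚ) :=
    ⨅ d, (harmonicSpace n k s).comap (homogeneousComponent d)
  have hP : ∀ {q}, q ∈ P ↔ ∀ d, homogeneousComponent d q ∈ harmonicSpace n k s := by
    simp [P, Submodule.mem_iInf]
  refine hP.1 (harmonicSpace_le (P := P) (fun c hc => ?_) (fun i f hf => ?_) hf) d
  · refine hP.2 fun d => ?_
    obtain ⟨e, he⟩ := exists_isHomogeneous_genVandermonde k c
    rw [homogeneousComponent_of_mem he]
    split_ifs
    · exact genVandermonde_mem_harmonicSpace k hc
    · exact zero_mem _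
  · refine hP.2 fun d => ?_
    rw [homogeneousComponent_pderiv]
    exact pderiv_mem_harmonicSpace i (hP.1 hf _)

/-- Orthogonal projection onto a finite-dimensional subspace on which a bilinear form is
anisotropic. -/
theorem exists_mem_forall_eq_of_anisotropic {K V : Type*} [Field K] [AddCommGroup V] [Module K V]
    (B : V →ₗ[K] V →ₗ[K] K) (S : Submodule K V) [FiniteDimensional K S]
    (hB : ∀ x ∈ S, B x x = 0 → x = 0) (p : V) : ∃ w ∈ S, ∀ y ∈ S, B w y = B p y := by
  let T : S →ₗ[K] Module.Dual K S := (LinearMap.lcomp K K S.subtype).comp (B.comp S.subtype)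
  have hT : Function.Injective T := by
    -- Anisotropy makes S → S* injective, hence bijective by dimension, so the functional B p on S
    -- is represented in S.
    rw [← LinearMap.ker_eq_bot, LinearMap.ker_eq_bot']
    intro x hx
    exact Subtype.ext (hB x x.2 (LinearMap.congr_fun hx x))
  have hT' : Function.Surjective T :=
    (LinearMap.injective_iff_surjective_of_finrank_eq_finrank Subspace.dual_finrank_eq.symm).1 hT
  obtain ⟨w, hw⟩ := hT' ((B p).comp S.subtype)
  exact ⟨w, w.2, fun y hy => LinearMap.congr_fun hw ⟨y, hy⟩⟩

/-- Every homogeneous polynomial is congruent to a homogeneous harmonic polynomial. -/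
theorem exists_mem_harmonicSpace_sub_mem {n k s d : ℕ} (hk : 1 ≤ k) (hs : s ≤ k)
    {p : MvPolynomial (Fin n) ℚ} (hp : p.IsHomogeneous d) :
    ∃ w ∈ harmonicSpace n k s, w.IsHomogeneous d ∧ p - w ∈ truncatedIdeal n k s := by
  -- Projecting within one degree keeps the space finite-dimensional; the other components of H are
  -- orthogonal for degree reasons.
  have hfin : FiniteDimensional ℚ (homogeneousSubmodule (Fin n) ℚ d) :=
    Module.Finite.iff_fg.2 (homogeneousSubmodule_fg _ _ d)
  have : FiniteDimensional ℚ
      (harmonicSpace n k s ⊓ homogeneousSubmodule (Fin n) ℚ d : Submodule ℚ _) :=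
    Submodule.finiteDimensional_of_le inf_le_right
  obtain ⟨w, ⟨hw, hwd⟩, h⟩ := exists_mem_forall_eq_of_anisotropic (apolar (Fin n))
    (harmonicSpace n k s ⊓ homogeneousSubmodule (Fin n) ℚ d)
    (fun x _ hx => eq_zero_of_apolar_self hx) p
  refine ⟨w, hw, hwd, mem_truncatedIdeal_of_apolar hk hs fun q hq => ?_⟩
  have hpw : (p - w).IsHomogeneous d := hp.sub hwd
  rw [← sum_homogeneousComponent q, map_sum]
  refine Finset.sum_eq_zero fun e _ => ?_
  by_cases hde : d = e
  · subst hde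
    rw [map_sub, LinearMap.sub_apply, h _ ⟨homogeneousComponent_mem_harmonicSpace hq d,
      homogeneousComponent_isHomogeneous d q⟩, sub_self]
  · exact apolar_eq_zero_of_isHomogeneous hpw (homogeneousComponent_isHomogeneous e q) hde

/-! ### The superspace Vandermonde in terms of generalized Vandermondes -/

/-- The product `θ_{c 0} θ_{c 1} ⋯` along a sequence of indices. -/
def thetaWord {n r : ℕ} (c : Fin r → Fin n) : ExteriorAlgebra ℚ (ThetaSpace n) :=
  ExteriorAlgebra.ιMulti ℚ r fun i => Pi.single (c i) 1

theorem thetaWord_eq_prod {n r : ℕ} (c : Fin r → Fin n) :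
    thetaWord c = ((List.ofFn c).map theta).prod := by
  rw [thetaWord, ExteriorAlgebra.ιMulti_apply, List.map_ofFn]
  rfl

theorem thetaWord_comp_perm {n r : ℕ} (c : Fin r → Fin n) (u : Equiv.Perm (Fin r)) :
    thetaWord (c ∘ u) = ((Equiv.Perm.sign u : ℤ) : ℚ) • thetaWord c := by
  have := (ExteriorAlgebra.ιMulti ℚ r (M := ThetaSpace n)).map_perm
    (fun i => Pi.single (c i) 1) u
  rw [thetaWord, thetaWord, Int.cast_smul_eq_zsmul, ← Units.smul_def, ← this]
  rfl

theorem permTheta_thetaWord {n r : ℕ} (c : Fin r → Fin n) (w : Equiv.Perm (Fin n)) :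
    permTheta w (thetaWord c) = thetaWord (w ∘ c) := by
  rw [thetaWord_eq_prod, thetaWord_eq_prod, map_list_prod, List.map_map, List.map_ofFn,
    List.map_ofFn]
  congr 2
  ext i
  exact permTheta_theta w (c i)

/-- The permutation of `Fin (r + k)` that permutes the two blocks separately. -/
def blockPerm {r k : ℕ} (u : Equiv.Perm (Fin r)) (v : Equiv.Perm (Fin k)) :
    Equiv.Perm (Fin (r + k)) :=
  finSumFinEquiv.permCongr (Equiv.Perm.sumCongr u v)

theorem blockPerm_castAdd {r k : ℕ} (u : Equiv.Perm (Fin r)) (v : Equiv.Perm (Fin k))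
    (i : Fin r) : blockPerm u v (Fin.castAdd k i) = Fin.castAdd k (u i) := by
  simp [blockPerm, Equiv.permCongr_apply]

theorem blockPerm_natAdd {r k : ℕ} (u : Equiv.Perm (Fin r)) (v : Equiv.Perm (Fin k))
    (j : Fin k) : blockPerm u v (Fin.natAdd r j) = Fin.natAdd r (v j) := by
  simp [blockPerm, Equiv.permCongr_apply]

theorem sign_blockPerm {r k : ℕ} (u : Equiv.Perm (Fin r)) (v : Equiv.Perm (Fin k)) :
    Equiv.Perm.sign (blockPerm u v) = Equiv.Perm.sign u * Equiv.Perm.sign v := by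
  rw [blockPerm, Equiv.Perm.sign_permCongr, Equiv.Perm.sign_sumCongr]

theorem exists_eq_blockPerm {r k : ℕ} (w : Equiv.Perm (Fin (r + k)))
    (hw : ∀ i, ∃ j, w (Fin.castAdd k j) = Fin.castAdd k i) : ∃ u v, w = blockPerm u v := by
  -- The hypothesis says exactly that `w⁻¹` maps the first block into itself.
  have h : (finSumFinEquiv.symm.permCongr w⁻¹ : Equiv.Perm (Fin r ⊕ Fin k)) ∈
      (Equiv.Perm.sumCongrHom (Fin r) (Fin k)).range := by
    apply Equiv.Perm.mem_sumCongrHom_range_of_perm_mapsTo_inl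
    rintro _ ⟨i, rfl⟩
    obtain ⟨j, hj⟩ := hw i
    refine ⟨j, ?_⟩
    simp [Equiv.permCongr_apply, ← hj]
  obtain ⟨⟨u, v⟩, huv⟩ := h
  refine ⟨u⁻¹, v⁻¹, ?_⟩
  have h2 : w⁻¹ = finSumFinEquiv.permCongr (Equiv.Perm.sumCongr u v) := by
    rw [Equiv.Perm.sumCongrHom_apply] at huv
    rw [huv]
    ext x
    simp [Equiv.permCongr_apply]
  rw [← inv_inv w, h2]
  rfl

/-- The monomial whose antisymmetrization gives the superspace Vandermonde. -/
def vandermondeMonomial (r k : ℕ) : MvPolynomial (Fin (r + k)) ℚ :=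
  (∏ i : Fin r, X (Fin.castAdd k i) ^ (k - 1)) *
    ∏ j : Fin k, X (Fin.natAdd r j) ^ (k - 1 - (j : ℕ))

theorem superVandermonde_eq_sum (r k : ℕ) :
    superVandermonde k (fun _ : Fin r => k - 1) = ∑ w : Equiv.Perm (Fin (r + k)),
      ((Equiv.Perm.sign w : ℤ) : ℚ) •
        (rename w (vandermondeMonomial r k) ⊗ₜ[ℚ] thetaWord (w ∘ Fin.castAdd k)) := by
  rw [superVandermonde, antisymmetrize]
  refine Finset.sum_congr rfl fun w _ => ?_
  rw [← permTheta_thetaWord, thetaWord_eq_prod, List.map_ofFn]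
  rfl

theorem compl_image_natAdd (r k : ℕ) : (Finset.univ.image (Fin.natAdd (m := k) r))ᶜ =
    Finset.univ.image (Fin.castAdd k) := by
  ext i
  refine Fin.addCases (fun i => ?_) (fun i => ?_) i
  · simp [Fin.ext_iff]
    intro x; omega
  · simp [Fin.ext_iff]
    intro x; omega

/-- The exponents k - 1 - j decrease along the block while those of `Matrix.vandermonde` increase,
hence the sign of the reversal. -/
theorem sum_sign_smul_rename_blockPerm (r k : ℕ) :
    ∑ v : Equiv.Perm (Fin k), ((Equiv.Perm.sign v : ℤ) : ℚ) •
        rename (blockPerm 1 v) (vandermondeMonomial r k) =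
      ((Equiv.Perm.sign (Fin.revPerm : Equiv.Perm (Fin k)) : ℤ) : ℚ) •
        genVandermonde k (Fin.natAdd (m := k) r) := by
  have h := Matrix.det_permute' Fin.revPerm
    (Matrix.vandermonde fun a : Fin k => (X (Fin.natAdd r a) : MvPolynomial (Fin (r + k)) ℚ))
  rw [genVandermonde, compl_image_natAdd, Finset.prod_image (Fin.castAdd_injective r k).injOn,
    ← mul_smul_comm, smul_eq_C_mul, map_intCast, ← h, Matrix.det_apply', Finset.mul_sum]
  refine Finset.sum_congr rfl fun v _ => ?_
  rw [vandermondeMonomial, map_mul, map_prod, map_prod, smul_eq_C_mul, map_intCast]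
  simp only [map_pow, rename_X, blockPerm_castAdd, blockPerm_natAdd, Equiv.Perm.one_apply,
    Matrix.submatrix_apply, Matrix.vandermonde_apply, id, Fin.revPerm_apply, Fin.val_rev]
  rw [mul_left_comm]
  congr 2
  refine Finset.prod_congr rfl fun j _ => ?_
  rw [Nat.sub_sub, Nat.add_comm 1]

/-- Replacing w by `w * blockPerm 1 v` leaves the θ-word unchanged, as it sees only the first r
indices. Averaging over v in 𝔖_k turns each monomial into a Vandermonde; the factor k! clears the
denominator. -/
theorem factorial_smul_superVandermonde (r k : ℕ) :
    (k.factorial : ℚ) • superVandermonde k (fun _ : Fin r => k - 1) =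
      ((Equiv.Perm.sign (Fin.revPerm : Equiv.Perm (Fin k)) : ℤ) : ℚ) •
        ∑ w : Equiv.Perm (Fin (r + k)), ((Equiv.Perm.sign w : ℤ) : ℚ) •
          (genVandermonde k (w ∘ Fin.natAdd (m := k) r) ⊗ₜ[ℚ] thetaWord (w ∘ Fin.castAdd k)) := by
  have h1 : ∀ v : Equiv.Perm (Fin k), superVandermonde k (fun _ : Fin r => k - 1) =
      ∑ w : Equiv.Perm (Fin (r + k)), ((Equiv.Perm.sign w : ℤ) : ℚ) •
        (rename w (((Equiv.Perm.sign v : ℤ) : ℚ) •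
          rename (blockPerm 1 v) (vandermondeMonomial r k)) ⊗ₜ[ℚ]
            thetaWord (w ∘ Fin.castAdd k)) := by
    intro v
    rw [superVandermonde_eq_sum, ← Equiv.sum_comp (Equiv.mulRight (blockPerm 1 v))]
    refine Finset.sum_congr rfl fun w _ => ?_
    have h2 : ⇑(w * blockPerm (1 : Equiv.Perm (Fin r)) v) ∘ Fin.castAdd k = w ∘ Fin.castAdd k := by
      ext i
      simp [blockPerm_castAdd]
    rw [Equiv.coe_mulRight, h2, map_smul, rename_rename, ← Equiv.Perm.coe_mul, map_mul,
      sign_blockPerm, map_one, one_mul, ← TensorProduct.smul_tmul', smul_smul]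
    push_cast
    rfl
  have h3 : (k.factorial : ℚ) • superVandermonde k (fun _ : Fin r => k - 1) =
      ∑ _v : Equiv.Perm (Fin k), superVandermonde k (fun _ : Fin r => k - 1) := by
    rw [Finset.sum_const, Finset.card_univ, Fintype.card_perm, Fintype.card_fin,
      Nat.cast_smul_eq_nsmul]
  rw [h3, Finset.sum_congr rfl fun v _ => h1 v, Finset.sum_comm, Finset.smul_sum]
  refine Finset.sum_congr rfl fun w _ => ?_
  rw [← Finset.smul_sum, ← TensorProduct.sum_tmul, ← map_sum, sum_sign_smul_rename_blockPerm,
    map_smul, rename_genVandermonde, ← TensorProduct.smul_tmul', smul_comm]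

/-! ### Comparing W with the harmonic space -/

/-- The superpolynomials whose coefficients are harmonic polynomials. -/
def harmonicSuperspace (n k s : ℕ) : Submodule ℚ (Superspace n) :=
  LinearMap.range (TensorProduct.map (harmonicSpace n k s).subtype
    (LinearMap.id : ExteriorAlgebra ℚ (ThetaSpace n) →ₗ[ℚ] _))

theorem tmul_mem_harmonicSuperspace {n k s : ℕ} {p : MvPolynomial (Fin n) ℚ}
    (hp : p ∈ harmonicSpace n k s) (q : ExteriorAlgebra ℚ (ThetaSpace n)) :
    p ⊗ₜ q ∈ harmonicSuperspace n k s :=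
  ⟨⟨p, hp⟩ ⊗ₜ q, rfl⟩

theorem harmonicSuperspace_le {n k s : ℕ} {P : Submodule ℚ (Superspace n)}
    (h : ∀ p ∈ harmonicSpace n k s, ∀ q, p ⊗ₜ q ∈ P) : harmonicSuperspace n k s ≤ P := by
  rintro _ ⟨f, rfl⟩
  induction f using TensorProduct.induction_on with
  | zero => simp
  | add f g hf hg => simpa only [map_add] using add_mem hf hg
  | tmul p q => exact h p p.2 q

theorem W_le_harmonicSuperspace (r k : ℕ) :
    W k (fun _ : Fin r => k - 1) ≤ harmonicSuperspace (r + k) k k := by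
  refine sInf_le ⟨?_, fun i => ?_, fun i => ?_⟩
  · have h : (k.factorial : ℚ) • superVandermonde k (fun _ : Fin r => k - 1) ∈
        harmonicSuperspace (r + k) k k := by
      rw [factorial_smul_superVandermonde]
      refine Submodule.smul_mem _ _ (Submodule.sum_mem _ fun w _ => Submodule.smul_mem _ _ ?_)
      exact tmul_mem_harmonicSuperspace (genVandermonde_mem_harmonicSpace k
        (w.injective.comp (Fin.natAdd_injective k r))) _
    exact (Submodule.smul_mem_iff _ (by positivity)).1 h
  · exact harmonicSuperspace_le (P := (harmonicSuperspace (r + k) k k).comap (partialX i))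
      fun p hp q => tmul_mem_harmonicSuperspace (pderiv_mem_harmonicSpace i hp) q
  · exact harmonicSuperspace_le (P := (harmonicSuperspace (r + k) k k).comap (partialTheta i))
      fun p hp q => tmul_mem_harmonicSuperspace hp _

/-- Successive contraction by the coordinate functionals in a list of indices. -/
def contractWord {n : ℕ} : List (Fin n) →
    ExteriorAlgebra ℚ (ThetaSpace n) →ₗ[ℚ] ExteriorAlgebra ℚ (ThetaSpace n)
  | [] => LinearMap.id
  | i :: l => contractWord l ∘ₗ contractTheta i

theorem contractTheta_theta_mul {n : ℕ} (i j : Fin n) (q : ExteriorAlgebra ℚ (ThetaSpace n)) :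
    contractTheta i (theta j * q) = (if i = j then q else 0) - theta j * contractTheta i q := by
  have h : contractTheta i (theta j * q) =
      (LinearMap.proj i : Module.Dual ℚ (ThetaSpace n)) (Pi.single j 1) • q -
        theta j * contractTheta i q := CliffordAlgebra.contractLeft_ι_mul _ _ _
  rw [h, LinearMap.proj_apply, Pi.single_apply]
  split_ifs <;> simp

theorem contractTheta_prod_eq_zero {n : ℕ} {i : Fin n} {l : List (Fin n)} (h : i ∉ l) :
    contractTheta i (l.map theta).prod = 0 := by
  induction l with
  | nil => exact CliffordAlgebra.contractLeft_one (Q := (0 : QuadraticForm ℚ (ThetaSpace n))) _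
  | cons j l ih =>
    rw [List.mem_cons, not_or] at h
    rw [List.map_cons, List.prod_cons, contractTheta_theta_mul, ih h.2, if_neg h.1]
    simp

theorem contractWord_prod {n : ℕ} {l : List (Fin n)} (h : l.Nodup) :
    contractWord l (l.map theta).prod = 1 := by
  induction l with
  | nil => rfl
  | cons j l ih =>
    rw [List.nodup_cons] at h
    rw [contractWord, LinearMap.comp_apply, List.map_cons, List.prod_cons, contractTheta_theta_mul,
      contractTheta_prod_eq_zero h.1, if_pos rfl, mul_zero, sub_zero, ih h.2]

/-- Contractions anticommute, so the one by i can be moved to act first. -/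
theorem contractWord_eq_zero {n : ℕ} {i : Fin n} {l : List (Fin n)} (hi : i ∈ l)
    {q : ExteriorAlgebra ℚ (ThetaSpace n)} (hq : contractTheta i q = 0) :
    contractWord l q = 0 := by
  induction l generalizing q with
  | nil => simp at hi
  | cons j l ih =>
    rw [contractWord, LinearMap.comp_apply]
    rcases List.mem_cons.1 hi with rfl | hi
    · rw [hq, map_zero]
    · refine ih hi ?_
      have h : contractTheta i (contractTheta j q) = -contractTheta j (contractTheta i q) :=
        CliffordAlgebra.contractLeft_comm _ _ _
      rw [h, hq, map_zero, neg_zero]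

theorem map_contractWord_mem_W {r k : ℕ} {a : Fin r → ℕ} (l : List (Fin (r + k)))
    {f : Superspace (r + k)} (hf : f ∈ W k a) :
    TensorProduct.map LinearMap.id (contractWord l) f ∈ W k a := by
  induction l generalizing f with
  | nil => simpa [contractWord] using hf
  | cons i l ih =>
    have h : partialTheta i f ∈ W k a :=
      Submodule.mem_sInf.2 fun p hp => hp.2.2 i f (Submodule.mem_sInf.1 hf p hp)
    have := ih h
    rwa [partialTheta, ← LinearMap.comp_apply, ← TensorProduct.map_comp] at this

/-- Contracting by θ_1, …, θ_r kills each word that misses one of them. The surviving w permute the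
two blocks by some u and v; the θ-word gives sign u, the Vandermonde gives sign v, and sign w
cancels both. All survivors therefore contribute equally. -/
theorem sign_smul_genVandermonde_tmul_contractWord (r k : ℕ) (w : Equiv.Perm (Fin (r + k))) :
    ((Equiv.Perm.sign w : ℤ) : ℚ) • (genVandermonde k (w ∘ Fin.natAdd (m := k) r) ⊗ₜ[ℚ]
        contractWord (List.ofFn (Fin.castAdd k)) (thetaWord (w ∘ Fin.castAdd k))) =
      open Classical in
      if ∀ i, ∃ j, w (Fin.castAdd k j) = Fin.castAdd k i then
        genVandermonde k (Fin.natAdd (m := k) r) ⊗ₜ 1 else 0 := by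
  split_ifs with hw
  · obtain ⟨u, v, rfl⟩ := exists_eq_blockPerm w hw
    have h1 : blockPerm u v ∘ Fin.natAdd (m := k) r = Fin.natAdd r ∘ v :=
      funext fun j => blockPerm_natAdd u v j
    have h2 : blockPerm u v ∘ Fin.castAdd k = Fin.castAdd k ∘ u :=
      funext fun j => blockPerm_castAdd u v j
    rw [h1, h2, genVandermonde_comp_perm, thetaWord_comp_perm, map_smul, thetaWord_eq_prod,
      contractWord_prod (List.nodup_ofFn.2 (Fin.castAdd_injective r k)), sign_blockPerm,
      TensorProduct.smul_tmul_smul, smul_smul]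
    rcases Int.units_eq_one_or (Equiv.Perm.sign u) with h | h <;>
      rcases Int.units_eq_one_or (Equiv.Perm.sign v) with h' | h' <;> simp [h, h']
  · push Not at hw
    obtain ⟨i, hi⟩ := hw
    rw [thetaWord_eq_prod, contractWord_eq_zero (i := Fin.castAdd k i), TensorProduct.tmul_zero,
      smul_zero]
    · simp [List.mem_ofFn]
    · apply contractTheta_prod_eq_zero
      simpa [List.mem_ofFn] using hi

theorem genVandermonde_natAdd_tmul_one_mem_W (r k : ℕ) :
    genVandermonde k (Fin.natAdd (m := k) r) ⊗ₜ[ℚ] 1 ∈ W k (fun _ : Fin r => k - 1) := by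
  classical
  have h0 : superVandermonde k (fun _ : Fin r => k - 1) ∈ W k (fun _ : Fin r => k - 1) :=
    Submodule.mem_sInf.2 fun p hp => hp.1
  have h := map_contractWord_mem_W (List.ofFn (Fin.castAdd k))
    (Submodule.smul_mem _ (k.factorial : ℚ) h0)
  rw [factorial_smul_superVandermonde, map_smul, map_sum] at h
  simp only [map_smul, TensorProduct.map_tmul, LinearMap.id_apply,
    sign_smul_genVandermonde_tmul_contractWord] at h
  rw [← Finset.sum_filter, Finset.sum_const, ← Nat.cast_smul_eq_nsmul ℚ, smul_smul] at h
  -- The scalar is a sign times the number of surviving permutations, which include the identity.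
  refine (Submodule.smul_mem_iff _ (mul_ne_zero ?_ ?_)).1 h
  · simp
  · rw [Nat.cast_ne_zero, Finset.card_ne_zero]
    exact ⟨1, by simp⟩

theorem tmul_one_mem_W {r k : ℕ} {p : MvPolynomial (Fin (r + k)) ℚ}
    (hp : p ∈ harmonicSpace (r + k) k k) : p ⊗ₜ[ℚ] 1 ∈ W k (fun _ : Fin r => k - 1) := by
  refine harmonicSpace_le (P := (W k (fun _ : Fin r => k - 1)).comap
    ((TensorProduct.mk ℚ _ (ExteriorAlgebra ℚ (ThetaSpace (r + k)))).flip 1))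
    (fun c hc => ?_) (fun i f hf => ?_) hp
  -- Any injective c extends to a permutation carrying the last block to it, and W is stable under
  -- 𝔖_n.
  · obtain ⟨w, hw⟩ := Equiv.Perm.exists_extending_pair (Fin.natAdd (m := k) r) c
      (Fin.natAdd_injective k r) hc
    have h := superRep_mem_W k _ w (genVandermonde_natAdd_tmul_one_mem_W r k)
    have h2 : w ∘ Fin.natAdd r = c := funext hw
    rw [← h2]
    simpa [superRep, rename_genVandermonde] using h
  · rw [Submodule.mem_comap] at hf ⊢
    have : partialX i (f ⊗ₜ 1) ∈ W k (fun _ : Fin r => k - 1) :=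
      Submodule.mem_sInf.2 fun p hp => hp.2.1 i _ (Submodule.mem_sInf.1 hf p hp)
    simpa [partialX] using this

/-! ### The θ-degree zero part and the isomorphism -/

/-- The part of `θ`-degree zero of a superpolynomial, as a polynomial. -/
def thetaConstantCoeff (n : ℕ) : Superspace n →ₗ[ℚ] MvPolynomial (Fin n) ℚ :=
  (TensorProduct.rid ℚ (MvPolynomial (Fin n) ℚ)).toLinearMap ∘ₗ
    TensorProduct.map LinearMap.id ExteriorAlgebra.algebraMapInv.toLinearMap

theorem thetaConstantCoeff_tmul {n : ℕ} (p : MvPolynomial (Fin n) ℚ)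
    (q : ExteriorAlgebra ℚ (ThetaSpace n)) :
    thetaConstantCoeff n (p ⊗ₜ q) = ExteriorAlgebra.algebraMapInv q • p := by
  simp [thetaConstantCoeff]

theorem thetaConstantCoeff_tmul_one {n : ℕ} (p : MvPolynomial (Fin n) ℚ) :
    thetaConstantCoeff n (p ⊗ₜ 1) = p := by
  rw [thetaConstantCoeff_tmul, map_one, one_smul]

theorem thetaConstantCoeff_tmul_one_eq {n : ℕ} {f : Superspace n} (hf : f ∈ thetaDegree n 0) :
    thetaConstantCoeff n f ⊗ₜ 1 = f := by
  obtain ⟨g, rfl⟩ := hf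
  induction g using TensorProduct.induction_on with
  | zero => simp
  | add f g hf hg => rw [map_add, map_add, TensorProduct.add_tmul, hf, hg]
  | tmul p q =>
    obtain ⟨q, hq⟩ := q
    rw [ExteriorAlgebra.exteriorPower, pow_zero] at hq
    obtain ⟨c, rfl⟩ := Submodule.mem_one.1 hq
    rw [TensorProduct.map_tmul, Submodule.subtype_apply, thetaConstantCoeff_tmul,
      ExteriorAlgebra.algebraMap_leftInverse, TensorProduct.smul_tmul, ← Algebra.algebraMap_eq_smul_one]

theorem tmul_one_mem_thetaDegree {n : ℕ} (p : MvPolynomial (Fin n) ℚ) :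
    p ⊗ₜ 1 ∈ thetaDegree n 0 := by
  have h : (1 : ExteriorAlgebra ℚ (ThetaSpace n)) ∈ ⋀[ℚ]^0 (ThetaSpace n) := by
    rw [ExteriorAlgebra.exteriorPower, pow_zero]
    exact Submodule.one_le.1 le_rfl
  exact ⟨p ⊗ₜ ⟨1, h⟩, rfl⟩

theorem thetaConstantCoeff_mem_harmonicSpace {n k s : ℕ} {f : Superspace n}
    (hf : f ∈ harmonicSuperspace n k s) : thetaConstantCoeff n f ∈ harmonicSpace n k s :=
  harmonicSuperspace_le (P := (harmonicSpace n k s).comap (thetaConstantCoeff n))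
    (fun p hp q => by
      rw [Submodule.mem_comap, thetaConstantCoeff_tmul]
      exact Submodule.smul_mem _ _ hp) hf

theorem isHomogeneous_thetaConstantCoeff {n d : ℕ} {f : Superspace n} (hf : f ∈ xDegree n d) :
    (thetaConstantCoeff n f).IsHomogeneous d := by
  obtain ⟨g, rfl⟩ := hf
  induction g using TensorProduct.induction_on with
  | zero => simpa using isHomogeneous_zero _ _ _
  | add f g hf hg => simpa only [map_add] using hf.add hg
  | tmul p q =>
    rw [TensorProduct.map_tmul, thetaConstantCoeff_tmul]
    exact (homogeneousSubmodule (Fin n) ℚ d).smul_mem _ p.2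

theorem mem_WZero_iff {r k : ℕ} {f : Superspace (r + k)} :
    f ∈ WZero k (fun _ : Fin r => k - 1) ↔ ∃ p ∈ harmonicSpace (r + k) k k, p ⊗ₜ 1 = f := by
  constructor
  · intro hf
    exact ⟨_, thetaConstantCoeff_mem_harmonicSpace (W_le_harmonicSuperspace r k hf.1),
      thetaConstantCoeff_tmul_one_eq hf.2⟩
  · rintro ⟨p, hp, rfl⟩
    exact ⟨tmul_one_mem_W hp, tmul_one_mem_thetaDegree p⟩

/-- The map from `W_n(a)_0` to the generalized coinvariant ring which sends a polynomial to its
residue class. -/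
def WZeroToGenCoinvariantRing (r k : ℕ) :
    WZero k (fun _ : Fin r => k - 1) →ₗ[ℚ] GenCoinvariantRing (r + k) k :=
  (Ideal.Quotient.mkₐ ℚ (genCoinvariantIdeal (r + k) k)).toLinearMap ∘ₗ
    thetaConstantCoeff (r + k) ∘ₗ (WZero k fun _ : Fin r => k - 1).subtype

theorem WZeroToGenCoinvariantRing_apply {r k : ℕ} (p : MvPolynomial (Fin (r + k)) ℚ)
    (h : p ⊗ₜ 1 ∈ WZero k (fun _ : Fin r => k - 1)) :
    WZeroToGenCoinvariantRing r k ⟨p ⊗ₜ 1, h⟩ = Ideal.Quotient.mk _ p :=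
  congrArg (Ideal.Quotient.mk _) (thetaConstantCoeff_tmul_one p)

theorem WZeroToGenCoinvariantRing_injective {r k : ℕ} (hk : 1 ≤ k) :
    Function.Injective (WZeroToGenCoinvariantRing r k) := by
  refine (injective_iff_map_eq_zero _).2 ?_
  rintro ⟨f, hf⟩ h
  obtain ⟨p, hp, rfl⟩ := mem_WZero_iff.1 hf
  rw [WZeroToGenCoinvariantRing_apply, Ideal.Quotient.eq_zero_iff_mem] at h
  -- `genCoinvariantIdeal` unfolds to `truncatedIdeal` with s = k, so p is both in I and in H and is
  -- orthogonal to itself.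
  have h0 : p = 0 := eq_zero_of_apolar_self (apolar_eq_zero_of_mem hk le_rfl h hp)
  subst h0
  exact Subtype.ext (TensorProduct.zero_tmul _ _)

theorem map_WZeroDegree {r k : ℕ} (hk : 1 ≤ k) (d : ℕ) :
    (WZeroDegree k (fun _ : Fin r => k - 1) d).map (WZeroToGenCoinvariantRing r k) =
      genCoinvariantDegree (r + k) k d := by
  apply le_antisymm
  · rintro _ ⟨f, hf, rfl⟩
    exact ⟨_, isHomogeneous_thetaConstantCoeff hf, rfl⟩
  · rintro _ ⟨p, hp, rfl⟩
    obtain ⟨w, hw, hwd, hpw⟩ := exists_mem_harmonicSpace_sub_mem (k := k) hk le_rfl hp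
    refine ⟨⟨w ⊗ₜ 1, mem_WZero_iff.2 ⟨w, hw, rfl⟩⟩, ⟨⟨w, hwd⟩ ⊗ₜ 1, rfl⟩, ?_⟩
    rw [WZeroToGenCoinvariantRing_apply]
    exact (Ideal.Quotient.eq.2 hpw).symm

theorem WZeroToGenCoinvariantRing_surjective {r k : ℕ} (hk : 1 ≤ k) :
    Function.Surjective (WZeroToGenCoinvariantRing r k) := by
  intro x
  obtain ⟨p, rfl⟩ := Ideal.Quotient.mk_surjective x
  rw [← LinearMap.mem_range, ← sum_homogeneousComponent p, map_sum]
  refine Submodule.sum_mem _ fun d _ => ?_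
  have h : Ideal.Quotient.mk _ (homogeneousComponent d p) ∈ genCoinvariantDegree (r + k) k d :=
    ⟨_, homogeneousComponent_isHomogeneous d p, rfl⟩
  rw [← map_WZeroDegree hk] at h
  exact LinearMap.map_le_range h

theorem WZeroToGenCoinvariantRing_comp_rep (r k : ℕ) (w : Equiv.Perm (Fin (r + k))) :
    WZeroToGenCoinvariantRing r k ∘ₗ WZeroRep k (fun _ => k - 1) w =
      genCoinvariantRep (r + k) k w ∘ₗ WZeroToGenCoinvariantRing r k := by
  ext ⟨f, hf⟩
  obtain ⟨p, hp, rfl⟩ := mem_WZero_iff.1 hf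
  have h : superRep (r + k) w (p ⊗ₜ 1) = rename w p ⊗ₜ 1 := by simp [superRep]
  rw [LinearMap.comp_apply, LinearMap.comp_apply, WZeroToGenCoinvariantRing_apply]
  change Ideal.Quotient.mk _ (thetaConstantCoeff _ (superRep (r + k) w (p ⊗ₜ 1))) = _
  rw [h, thetaConstantCoeff_tmul_one]
  rfl

end SuperVandermonde

end

theorem mainTheorem11 (r k : ℕ) (hk : 1 ≤ k) :
    ∃ φ : (SuperVandermonde.WZeroRep k (fun _ : Fin r => k - 1)).Equiv
        (SuperVandermonde.genCoinvariantRep (r + k) k),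
      ∀ d : ℕ,
        (SuperVandermonde.WZeroDegree k (fun _ : Fin r => k - 1) d).map φ.toLinearMap =
          SuperVandermonde.genCoinvariantDegree (r + k) k d :=
  ⟨.mk (LinearEquiv.ofBijective (SuperVandermonde.WZeroToGenCoinvariantRing r k)
      ⟨SuperVandermonde.WZeroToGenCoinvariantRing_injective hk,
        SuperVandermonde.WZeroToGenCoinvariantRing_surjective hk⟩)
      (SuperVandermonde.WZeroToGenCoinvariantRing_comp_rep r k),
    SuperVandermonde.map_WZeroDegree hk⟩
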